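/- Fix a constant $k$. A \emph{grounded segment} is a closed segment in the plane with one endpoint on a fixed horizontal line (the ground line) and the other one, its \emph{free endpoint}, strictly above that line. There is an algorithm (a program for the real RAM, with exact real arithmetic and comparisons at unit cost) which, given $n$ segments grounded on a common horizontal line whose free endpoints lie on $k$ lines of arbitrary slope, computes in $O(n^{O(1)})$ time a maximum clique of their intersection graph, that is, of the graph whose vertices are the segments and in which two different segments are adjacent if and only if they intersect. The program, the exponent and the constant hidden in the $O$-notation may depend on $k$, but not on $n$ or on the segments; the $k$ lines are not part of the input. -/

import Mathlib

open Filter Asymptotics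

/-! ## A real RAM

Programs work on finitely many named arrays of natural numbers and finitely many named arrays of
real numbers; each array is indexed by `ℕ`.  An array is named by a number that stands in the text
of the program, its cells are addressed by values computed at run time, and a scalar variable is
the cell `0` of an array.  Exact real arithmetic and comparisons of reals cost one step each; there
is no rounding, no conversion from reals to natural numbers, and the only constants are natural
numbers.  On natural numbers only addition, truncated subtraction and comparison are elementary, so
that no long computation can be hidden in the arithmetic of indices. -/

namespace RealRAM

/-- The contents of the memory: `nat a i` and `real a i` are the cells `i` of the arrays named `a`
of natural and of real numbers. -/
structure State where
  nat : ℕ → ℕ → ℕ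
  real : ℕ → ℕ → ℝ

/-- Expressions with values in the natural numbers. -/
inductive NExp where
  | const (c : ℕ)
  | get (a : ℕ) (i : NExp)
  | add (e f : NExp)
  | sub (e f : NExp)

/-- Expressions with values in the real numbers. -/
inductive RExp where
  | const (c : ℕ)
  | get (a : ℕ) (i : NExp)
  | add (e f : RExp)
  | sub (e f : RExp)
  | mul (e f : RExp)
  | div (e f : RExp)

/-- Tests, used to branch and to loop. -/
inductive Test where
  | natLt (e f : NExp)
  | realLt (e f : RExp)
  | not (b : Test)
  | and (b c : Test)

/-- Programs. -/
inductive Prog where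
  | skip
  | natSet (a : ℕ) (i e : NExp)
  | realSet (a : ℕ) (i : NExp) (e : RExp)
  | seq (p q : Prog)
  | ite (b : Test) (p q : Prog)
  | while (b : Test) (p : Prog)

/-- The value of an expression. -/
def NExp.eval (s : State) : NExp → ℕ
  | const c => c
  | get a i => s.nat a (i.eval s)
  | add e f => e.eval s + f.eval s
  | sub e f => e.eval s - f.eval s

/-- The number of steps that it takes to evaluate an expression: one for every constant, memory
access and arithmetic operation. -/
def NExp.cost : NExp → ℕ
  | const _ => 1
  | get _ i => i.cost + 1
  | add e f => e.cost + f.cost + 1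
  | sub e f => e.cost + f.cost + 1

/-- The value of an expression (a quotient with denominator `0` has the value `0`). -/
noncomputable def RExp.eval (s : State) : RExp → ℝ
  | const c => (c : ℝ)
  | get a i => s.real a (i.eval s)
  | add e f => e.eval s + f.eval s
  | sub e f => e.eval s - f.eval s
  | mul e f => e.eval s * f.eval s
  | div e f => e.eval s / f.eval s

/-- The number of steps that it takes to evaluate an expression. -/
def RExp.cost : RExp → ℕ
  | const _ => 1
  | get _ i => i.cost + 1
  | add e f => e.cost + f.cost + 1
  | sub e f => e.cost + f.cost + 1
  | mul e f => e.cost + f.cost + 1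
  | div e f => e.cost + f.cost + 1

/-- The outcome of a test. -/
def Test.Holds (s : State) : Test → Prop
  | natLt e f => e.eval s < f.eval s
  | realLt e f => e.eval s < f.eval s
  | not b => ¬ b.Holds s
  | and b c => b.Holds s ∧ c.Holds s

/-- The number of steps that a test takes. -/
def Test.cost : Test → ℕ
  | natLt e f => e.cost + f.cost + 1
  | realLt e f => e.cost + f.cost + 1
  | not b => b.cost + 1
  | and b c => b.cost + c.cost + 1

/-- The memory after writing `v` into the cell `i` of the array `a` of natural numbers. -/
def State.setNat (s : State) (a i v : ℕ) : State where
  nat := Function.update s.nat a (Function.update (s.nat a) i v)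
  real := s.real

/-- The memory after writing `v` into the cell `i` of the array `a` of real numbers. -/
def State.setReal (s : State) (a i : ℕ) (v : ℝ) : State where
  nat := s.nat
  real := Function.update s.real a (Function.update (s.real a) i v)

/-- `Runs p s t s'`: started with the memory `s`, the program `p` halts after exactly `t` steps
with the memory `s'`. -/
inductive Runs : Prog → State → ℕ → State → Prop where
  | skip (s : State) : Runs .skip s 1 s
  | natSet (s : State) (a : ℕ) (i e : NExp) :
      Runs (.natSet a i e) s (i.cost + e.cost + 1) (s.setNat a (i.eval s) (e.eval s))
  | realSet (s : State) (a : ℕ) (i : NExp) (e : RExp) :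
      Runs (.realSet a i e) s (i.cost + e.cost + 1) (s.setReal a (i.eval s) (e.eval s))
  | seq {p q : Prog} {s s' s'' : State} {t t' : ℕ} (hp : Runs p s t s') (hq : Runs q s' t' s'') :
      Runs (.seq p q) s (t + t') s''
  | ite_true {b : Test} {p q : Prog} {s s' : State} {t : ℕ} (hb : b.Holds s)
      (hp : Runs p s t s') : Runs (.ite b p q) s (b.cost + t) s'
  | ite_false {b : Test} {p q : Prog} {s s' : State} {t : ℕ} (hb : ¬ b.Holds s)
      (hq : Runs q s t s') : Runs (.ite b p q) s (b.cost + t) s'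
  | while_true {b : Test} {p : Prog} {s s' s'' : State} {t t' : ℕ} (hb : b.Holds s)
      (hp : Runs p s t s') (hw : Runs (.while b p) s' t' s'') :
      Runs (.while b p) s (b.cost + t + t') s''
  | while_false {b : Test} {p : Prog} {s : State} (hb : ¬ b.Holds s) :
      Runs (.while b p) s b.cost s

end RealRAM

/-! ## Grounded segments -/

namespace GroundedSegments

/-- The endpoints of a segment in the plane: the grounded endpoint and the free endpoint. -/
structure Seg where
  grounded : ℝ × ℝ
  free : ℝ × ℝ

/-- The closed segment itself, as a set of points. -/
def Seg.points (s : Seg) : Set (ℝ × ℝ) := segment ℝ s.grounded s.free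

/-- All segments are grounded on one horizontal line: they have their grounded endpoints on it and
their free endpoints strictly above it. -/
def AreGrounded {n : ℕ} (S : Fin n → Seg) : Prop :=
  ∃ g : ℝ, ∀ i, (S i).grounded.2 = g ∧ g < (S i).free.2

/-- The free endpoints lie on `k` lines (of any slope, vertical lines included). -/
def FreeEndpointsOnLines {n : ℕ} (k : ℕ) (S : Fin n → Seg) : Prop :=
  ∃ L : Fin k → AffineSubspace ℝ (ℝ × ℝ),
    (∀ w, Module.finrank ℝ (L w).direction = 1) ∧ ∀ i, ∃ w, (S i).free ∈ L w

/-- The intersection graph: two different segments are adjacent when they have a common point. -/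
def intersectionGraph {n : ℕ} (S : Fin n → Seg) : SimpleGraph (Fin n) where
  Adj i j := i ≠ j ∧ ((S i).points ∩ (S j).points).Nonempty
  symm := ⟨fun _ _ h => ⟨h.1.symm, by rw [Set.inter_comm]; exact h.2⟩⟩
  loopless := ⟨fun _ h => h.1 rfl⟩

/-- The memory that presents the segments to a program: the number `n` of segments is in the cell
`0` of the array `0` of natural numbers; the `x`- and `y`-coordinates of the grounded endpoint and
the `x`- and `y`-coordinates of the free endpoint of the `i`-th segment are in the cells `i` of the
arrays `0`, `1`, `2`, `3` of real numbers; all other cells are `0`. -/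
noncomputable def inputState {n : ℕ} (S : Fin n → Seg) : RealRAM.State where
  nat a i := if a = 0 ∧ i = 0 then n else 0
  real a i :=
    if h : i < n then
      match a with
      | 0 => (S ⟨i, h⟩).grounded.1
      | 1 => (S ⟨i, h⟩).grounded.2
      | 2 => (S ⟨i, h⟩).free.1
      | 3 => (S ⟨i, h⟩).free.2
      | _ => 0
    else 0

/-- The set of segments that a program has put out: the cell `i` of the array `1` of natural
numbers is `1` for the segments in the set, and `0` for the other segments. -/
def Outputs {n : ℕ} (s : RealRAM.State) (M : Finset (Fin n)) : Prop :=
  ∀ i : Fin n, s.nat 1 i = if i ∈ M then 1 else 0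

/-- On every set of `n` grounded segments whose free endpoints lie on `k` lines, the program `p`
halts after at most `T n` steps and puts out a maximum clique of the intersection graph. -/
def FindsMaximumClique (p : RealRAM.Prog) (k : ℕ) (T : ℕ → ℕ) : Prop :=
  ∀ (n : ℕ) (S : Fin n → Seg), AreGrounded S → FreeEndpointsOnLines k S →
    ∃ (t : ℕ) (s : RealRAM.State) (M : Finset (Fin n)),
      RealRAM.Runs p (inputState S) t s ∧ t ≤ T n ∧
      Outputs s M ∧ (intersectionGraph S).IsMaximumClique M

end GroundedSegments

/-! ### Running time and correctness of real RAM programs -/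

namespace RealRAM

/-! Order the segments by grounded endpoint, with ties broken by tilt and index (`key`). For `i`
before `j`, intersecting amounts to the two inequalities of `Cross` (`points_inter_nonempty_iff`),
so cliques are the sets in which every earlier member crosses every later one (`isClique_iff`).

The `k` lines enter only through `hasRepresentatives`: in any set of segments, at most `5 * k`
members decide which segments cross the whole set. The first inequality of `Cross X y z` is affine
in the position of the free endpoint of `y` on its line, so two extreme endpoints per line suffice.
The second is affine in the position of the free endpoint of `z`, so on each line the set imposes an
intersection of half-lines, and three of them determine it.

A clique can therefore be grown in the order of `key` while remembering only its last member and its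
representatives, a tuple of `5 * k + 1` indices. A clique of `m + 1` segments yields a path of `m`
steps between tuples (`exists_isPathEnd`). Conversely, the first entries along any path form a
clique, because crossing everything in a later tuple forces crossing everything in the earlier ones.
A maximum clique is thus a longest path in a graph on `n ^ (5 * k + 1)` vertices, acyclic because
`key` increases. It is found by relaxing all pairs in `n` rounds (`reaches_pathProg`) and read off
backwards (`reaches_outputProg`).

`Reaches` tracks correctness and time together: no loop makes more than `n + n ^ (5 * k + 1)`
rounds, and for a fixed program `Prog.exists_bound_le` turns this into a polynomial bound. -/

@[simp] theorem State.setNat_real (s : State) (a i v : ℕ) : (s.setNat a i v).real = s.real := rfl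

@[simp] theorem State.setNat_nat (s : State) (a i v b j : ℕ) :
    (s.setNat a i v).nat b j = if b = a ∧ j = i then v else s.nat b j := by
  by_cases hb : b = a
  · subst hb
    by_cases hj : j = i <;> simp [State.setNat, hj]
  · simp [State.setNat, hb]

/-- A bound on the number of steps of a program each of whose loops makes at most `m` rounds. -/
def Prog.bound (m : ℕ) : Prog → ℕ
  | skip => 1
  | natSet _ i e => i.cost + e.cost + 1
  | realSet _ i e => i.cost + e.cost + 1
  | seq p q => p.bound m + q.bound m
  | ite b p q => b.cost + (p.bound m + q.bound m)
  | .while b p => m * (b.cost + p.bound m) + b.cost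

/-- Functions bounded by some `C * (m + 1) ^ d` are closed under sums and under multiplication by
`m`, which is all that `Prog.bound` uses. The exponent is not optimised: a sum simply adds the
exponents. -/
theorem Prog.exists_bound_le (p : Prog) : ∃ C d : ℕ, ∀ m, p.bound m ≤ C * (m + 1) ^ d := by
  have add_le : ∀ {f g : ℕ → ℕ}, (∃ C d : ℕ, ∀ m, f m ≤ C * (m + 1) ^ d) →
      (∃ C d : ℕ, ∀ m, g m ≤ C * (m + 1) ^ d) →
      ∃ C d : ℕ, ∀ m, f m + g m ≤ C * (m + 1) ^ d := by
    rintro f g ⟨C, d, h⟩ ⟨C', d', h'⟩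
    refine ⟨C + C', d + d', fun m => ?_⟩
    have h1 : (m + 1) ^ d ≤ (m + 1) ^ (d + d') := Nat.pow_le_pow_right (by omega) (by omega)
    have h2 : (m + 1) ^ d' ≤ (m + 1) ^ (d + d') := Nat.pow_le_pow_right (by omega) (by omega)
    calc f m + g m ≤ C * (m + 1) ^ d + C' * (m + 1) ^ d' := add_le_add (h m) (h' m)
      _ ≤ C * (m + 1) ^ (d + d') + C' * (m + 1) ^ (d + d') := by gcongr
      _ = _ := by ring
  have const_le : ∀ c : ℕ, ∃ C d : ℕ, ∀ m, (fun _ : ℕ => c) m ≤ C * (m + 1) ^ d :=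
    fun c => ⟨c, 0, fun m => by simp⟩
  induction p with
  | skip => exact const_le 1
  | natSet _ i e => exact const_le (i.cost + e.cost + 1)
  | realSet _ i e => exact const_le (i.cost + e.cost + 1)
  | seq p q hp hq => exact add_le hp hq
  | ite b p q hp hq => exact add_le (const_le b.cost) (add_le hp hq)
  -- The remaining constructor is `while`; its factor `m` raises the exponent by one.
  | _ =>
    rename_i b p hp
    refine add_le ?_ (const_le b.cost)
    obtain ⟨C, d, h⟩ := add_le (const_le b.cost) hp
    refine ⟨C, d + 1, fun m => ?_⟩
    calc m * (b.cost + p.bound m) ≤ (m + 1) * (C * (m + 1) ^ d) :=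
          Nat.mul_le_mul (by omega) (h m)
      _ = _ := by ring

/-- Started with `s`, the program `p` halts, within the time that it needs when its loops make at
most `m` rounds, with a memory that satisfies `Q`. -/
def Reaches (m : ℕ) (p : Prog) (s : State) (Q : State → Prop) : Prop :=
  ∃ t s', Runs p s t s' ∧ t ≤ p.bound m ∧ Q s'

theorem Reaches.mono {m : ℕ} {p : Prog} {s : State} {Q Q' : State → Prop}
    (h : Reaches m p s Q) (hQ : ∀ s', Q s' → Q' s') : Reaches m p s Q' := by
  obtain ⟨t, s', h1, h2, h3⟩ := h
  exact ⟨t, s', h1, h2, hQ _ h3⟩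

theorem reaches_skip {m : ℕ} {s : State} {Q : State → Prop} (h : Q s) : Reaches m .skip s Q :=
  ⟨1, s, .skip s, le_rfl, h⟩

theorem reaches_natSet {m a : ℕ} {i e : NExp} {s : State} {Q : State → Prop}
    (h : Q (s.setNat a (i.eval s) (e.eval s))) : Reaches m (.natSet a i e) s Q :=
  ⟨_, _, .natSet s a i e, le_rfl, h⟩

theorem reaches_seq {m : ℕ} {p q : Prog} {s : State} {Q : State → Prop}
    (h : Reaches m p s fun s' => Reaches m q s' Q) : Reaches m (.seq p q) s Q := by
  obtain ⟨t, s', h1, h2, t', s'', h3, h4, h5⟩ := h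
  exact ⟨_, _, .seq h1 h3, add_le_add h2 h4, h5⟩

theorem reaches_ite {m : ℕ} {b : Test} {p q : Prog} {s : State} {Q : State → Prop}
    (hp : b.Holds s → Reaches m p s Q) (hq : ¬ b.Holds s → Reaches m q s Q) :
    Reaches m (.ite b p q) s Q := by
  by_cases hb : b.Holds s
  · obtain ⟨t, s', h1, h2, h3⟩ := hp hb
    exact ⟨_, _, .ite_true hb h1, by simp only [Prog.bound]; omega, h3⟩
  · obtain ⟨t, s', h1, h2, h3⟩ := hq hb
    exact ⟨_, _, .ite_false hb h1, by simp only [Prog.bound]; omega, h3⟩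

/-- The scalar variable that is kept in the array `a`. -/
abbrev NExp.var (a : ℕ) : NExp := .get a (.const 0)

/-- Assignment to a scalar variable. -/
abbrev Prog.assign (a : ℕ) (e : NExp) : Prog := .natSet a (.const 0) e

/-- The loop `for v = 0, …, e - 1`. -/
def Prog.forLoop (v : ℕ) (e : NExp) (p : Prog) : Prog :=
  .seq (.assign v (.const 0))
    (.while (.natLt (.var v) e) (.seq p (.assign v (.add (.var v) (.const 1)))))

/-- Loop rule with an invariant indexed by the round. The bound `e` is evaluated anew in each round,
so the invariant must fix its value; the counter is an ordinary memory cell, so the invariant must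
survive writing to it and the body must leave it unchanged. -/
theorem reaches_forLoop {m r v : ℕ} {e : NExp} {p : Prog} {s : State} {Q : State → Prop}
    (Inv : ℕ → State → Prop) (hr : r ≤ m)
    (hstable : ∀ i s x, Inv i s → Inv i (s.setNat v 0 x))
    (hbound : ∀ i s, Inv i s → e.eval s = r)
    (hinit : Inv 0 s)
    (hbody : ∀ i s, i < r → s.nat v 0 = i → Inv i s →
      Reaches m p s fun s' => s'.nat v 0 = i ∧ Inv (i + 1) s')
    (hQ : ∀ s, Inv r s → Q s) : Reaches m (.forLoop v e p) s Q := by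
  have key : ∀ j i s, i + j = r → s.nat v 0 = i → Inv i s →
      ∃ t s', Runs (.while (.natLt (.var v) e) (.seq p (.assign v (.add (.var v) (.const 1)))))
        s t s' ∧ t ≤ j * ((Test.natLt (.var v) e).cost +
          (Prog.seq p (.assign v (.add (.var v) (.const 1)))).bound m)
          + (Test.natLt (.var v) e).cost ∧ Q s' := by
    intro j
    induction j with
    | zero =>
      intro i s hij hv hI
      refine ⟨_, s, .while_false ?_, by omega, hQ s ?_⟩
      · simp only [Test.Holds, NExp.eval, hv, hbound i s hI]; omega
      · obtain rfl : i = r := by omega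
        exact hI
    | succ j ih =>
      intro i s hij hv hI
      obtain ⟨t, s', h1, h2, h3, h4⟩ := hbody i s (by omega) hv hI
      obtain ⟨t', s'', h5, h6, h7⟩ := ih (i + 1) (s'.setNat v 0 (i + 1)) (by omega) (by simp)
        (hstable _ _ _ h4)
      refine ⟨_, s'', .while_true (t' := t') ?_ (.seq h1 (.natSet s' _ _ _)) ?_, ?_, h7⟩
      · simp only [Test.Holds, NExp.eval, hv, hbound i s hI]; omega
      · simpa [NExp.eval, h3] using h5
      · simp only [Prog.bound] at h6 ⊢
        rw [Nat.succ_mul]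
        omega
  apply reaches_seq
  apply reaches_natSet
  obtain ⟨t, s', h1, h2, h3⟩ := key r 0 (s.setNat v 0 0) (by omega) (by simp) (hstable _ _ _ hinit)
  refine ⟨t, s', h1, h2.trans ?_, h3⟩
  simp only [Prog.bound]
  gcongr

/-- The two memories differ in the arrays of natural numbers from `A` at most. -/
def SameExcept (A : Set ℕ) (s s' : State) : Prop :=
  s'.real = s.real ∧ ∀ a ∉ A, s'.nat a = s.nat a

theorem SameExcept.refl (A : Set ℕ) (s : State) : SameExcept A s s := ⟨rfl, fun _ _ => rfl⟩

theorem SameExcept.setNat {A : Set ℕ} {s s' : State} {a : ℕ} (h : SameExcept A s s') (ha : a ∈ A)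
    (i v : ℕ) : SameExcept A s (s'.setNat a i v) := by
  refine ⟨h.1, fun b hb => ?_⟩
  rw [← h.2 b hb]
  have : b ≠ a := fun e => hb (e ▸ ha)
  funext j
  simp [this]

/-- The conjunction of the tests `f j` for `j < K`. -/
def Test.all (f : ℕ → Test) : ℕ → Test
  | 0 => .natLt (.const 0) (.const 1)
  | K + 1 => .and (Test.all f K) (f K)

theorem Test.holds_all {f : ℕ → Test} {K : ℕ} {s : State} :
    (Test.all f K).Holds s ↔ ∀ j < K, (f j).Holds s := by
  induction K with
  | zero => simp [Test.all, Test.Holds, NExp.eval]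
  | succ K ih =>
    simp only [Test.all, Test.Holds, ih, Nat.lt_succ_iff_lt_or_eq, or_imp, forall_and, forall_eq]

/-- Disjunction of tests. -/
def Test.or (b c : Test) : Test := .not (.and (.not b) (.not c))

theorem Test.holds_or {b c : Test} {s : State} :
    (Test.or b c).Holds s ↔ b.Holds s ∨ c.Holds s := by
  simp only [Test.or, Test.Holds]
  tauto

end RealRAM

/-! ### Order and crossing of segments, encoding of tuples -/

namespace GroundedSegments

variable (X : ℕ → ℕ → ℝ)

/-- The reciprocal slope of the `i`-th segment. -/
noncomputable def tilt (i : ℕ) : ℝ := (X 2 i - X 0 i) / (X 3 i - X 1 i)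

/-- Segments are ordered by their grounded endpoints, then by their angles, then by their
indices. -/
noncomputable def key (i : ℕ) : ℝ ×ₗ ℝ ×ₗ ℕ := toLex (X 0 i, toLex (-tilt X i, i))

/-- The free endpoint of the `i`-th segment is not to the left of the line through the `j`-th one,
and the free endpoint of the `j`-th segment is not to the right of the line through the `i`-th one.
-/
def Cross (i j : ℕ) : Prop :=
  X 0 j + tilt X j * (X 3 i - X 1 i) ≤ X 2 i ∧ X 2 j ≤ X 0 i + tilt X i * (X 3 j - X 1 j)

variable {X}

theorem key_lt_key {i j : ℕ} : key X i < key X j ↔ X 0 i < X 0 j ∨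
    (X 0 i = X 0 j ∧ (tilt X j < tilt X i ∨ (tilt X j = tilt X i ∧ i < j))) := by
  simp only [key, Prod.Lex.toLex_lt_toLex, neg_lt_neg_iff, neg_inj]
  rw [eq_comm (a := tilt X i)]

/-- The index as last component separates even coinciding segments, so that `key` orders the
segments strictly. -/
theorem key_injective : Function.Injective (key X) := by
  intro i j h
  simp only [key, EmbeddingLike.apply_eq_iff_eq, Prod.mk.injEq] at h
  exact h.2.2

/-- The `j`-th digit of `c` in base `n`: numbers below `n ^ K` encode `K`-tuples. -/
def entry (n j c : ℕ) : ℕ := c / n ^ j % n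

theorem entry_lt {n : ℕ} (hn : 0 < n) (j c : ℕ) : entry n j c < n := Nat.mod_lt _ hn

theorem exists_entry_eq {n K : ℕ} (f : Fin K → Fin n) :
    ∃ c < n ^ K, ∀ j : Fin K, entry n j c = f j := by
  refine ⟨finFunctionFinEquiv f, (finFunctionFinEquiv f).2, fun j => ?_⟩
  have h := congrFun (finFunctionFinEquiv.symm_apply_apply f) j
  rw [← congrArg Fin.val h]
  rfl

/-- Every set of at most `K` indices is, together with `a`, the set of entries of a tuple with first
entry `a`. -/
theorem exists_tuple {n K a : ℕ} (ha : a < n) {W : Finset ℕ} (hW : ∀ w ∈ W, w < n)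
    (hK : W.card ≤ K) :
    ∃ c < n ^ (K + 1), entry n 0 c = a ∧ (∀ j < K + 1, entry n j c ∈ insert a W) ∧
      ∀ w ∈ W, ∃ j < K + 1, entry n j c = w := by
  -- The tuple lists `a` and then `W`; the default value of `getD` pads it with further copies of
  -- `a`.
  have hmem : ∀ j, (a :: W.toList).getD j a ∈ insert a W := by
    intro j
    by_cases hj : j < (a :: W.toList).length
    · rw [List.getD_eq_getElem _ _ hj]
      have := List.getElem_mem hj
      rwa [List.mem_cons, Finset.mem_toList, ← Finset.mem_insert] at this
    · rw [List.getD_eq_default _ _ (by omega)]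
      simp
  have hlt : ∀ j, (a :: W.toList).getD j a < n := by
    intro j
    rcases Finset.mem_insert.1 (hmem j) with h | h
    · omega
    · exact hW _ h
  obtain ⟨c, hc, h⟩ := exists_entry_eq (fun j : Fin (K + 1) =>
    (⟨(a :: W.toList).getD j a, hlt j⟩ : Fin n))
  refine ⟨c, hc, h 0, fun j hj => by rw [h ⟨j, hj⟩]; exact hmem j, fun w hw => ?_⟩
  obtain ⟨i, hi, rfl⟩ := List.getElem_of_mem (Finset.mem_toList.2 hw)
  have hi' : i < W.card := by simpa using hi
  refine ⟨i + 1, by omega, ?_⟩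
  rw [h ⟨i + 1, by omega⟩]
  change (a :: W.toList).getD (i + 1) a = _
  rw [List.getD_eq_getElem _ _ (by simpa using hi')]
  rfl

/-! ### Few representatives decide crossing -/

theorem exists_min_subset (Y : Finset ℕ) (f : ℕ → ℝ) :
    ∃ W ⊆ Y, W.card ≤ 1 ∧ ∀ y ∈ Y, ∃ w ∈ W, f w ≤ f y := by
  rcases Y.eq_empty_or_nonempty with rfl | hY
  · exact ⟨∅, by simp⟩
  · obtain ⟨w, hw, h⟩ := Y.exists_min_image f hY
    exact ⟨{w}, by simpa, by simp, fun y hy => ⟨w, by simp, h y hy⟩⟩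

/-- Half-planes that contain the extreme points of a set of points on a line contain the set. -/
theorem exists_extreme_points (Y : Finset ℕ) (t : ℕ → ℝ) :
    ∃ W ⊆ Y, W.card ≤ 2 ∧ ∀ α β : ℝ, (∀ w ∈ W, 0 ≤ α + β * t w) → ∀ y ∈ Y, 0 ≤ α + β * t y := by
  obtain ⟨W₁, h₁, c₁, m₁⟩ := exists_min_subset Y t
  obtain ⟨W₂, h₂, c₂, m₂⟩ := exists_min_subset Y (fun y => -t y)
  refine ⟨W₁ ∪ W₂, Finset.union_subset h₁ h₂, (Finset.card_union_le _ _).trans (by omega),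
    fun α β h y hy => ?_⟩
  -- An affine function attains its minimum at the least or at the greatest parameter, according to
  -- the sign of its slope.
  rcases le_total 0 β with hβ | hβ
  · obtain ⟨w, hw, hle⟩ := m₁ y hy
    have := h w (Finset.mem_union_left _ hw)
    nlinarith
  · obtain ⟨w, hw, hle⟩ := m₂ y hy
    have := h w (Finset.mem_union_right _ hw)
    nlinarith

/-- An intersection of half-lines is already the intersection of at most three of them. -/
theorem exists_extreme_halflines (Y : Finset ℕ) (α β : ℕ → ℝ) :
    ∃ W ⊆ Y, W.card ≤ 3 ∧ ∀ t : ℝ, (∀ w ∈ W, 0 ≤ α w + β w * t) → ∀ y ∈ Y, 0 ≤ α y + β y * t := by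
  -- For `β > 0` the condition reads `-(α / β) ≤ t`, tightest for the least `α / β`; for `β < 0` it
  -- reads `t ≤ -(α / β)`, tightest for the greatest; for `β = 0` it does not involve `t`, and the
  -- least `α` is the strictest.
  obtain ⟨W₁, h₁, c₁, m₁⟩ := exists_min_subset (Y.filter fun y => 0 < β y) (fun y => α y / β y)
  obtain ⟨W₂, h₂, c₂, m₂⟩ := exists_min_subset (Y.filter fun y => β y < 0) (fun y => -(α y / β y))
  obtain ⟨W₃, h₃, c₃, m₃⟩ := exists_min_subset (Y.filter fun y => β y = 0) α
  refine ⟨W₁ ∪ W₂ ∪ W₃, ?_, ?_, fun t h y hy => ?_⟩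
  · exact Finset.union_subset (Finset.union_subset (h₁.trans (Finset.filter_subset _ _))
      (h₂.trans (Finset.filter_subset _ _))) (h₃.trans (Finset.filter_subset _ _))
  · have := Finset.card_union_le (W₁ ∪ W₂) W₃
    have := Finset.card_union_le W₁ W₂
    omega
  · rcases lt_trichotomy (β y) 0 with hβ | hβ | hβ
    · obtain ⟨w, hw, hle⟩ := m₂ y (by simp [hy, hβ])
      have hw' : β w < 0 := (Finset.mem_filter.1 (h₂ hw)).2
      have h0 := h w (by simp [hw])
      have e1 : α w / β w * β w = α w := div_mul_cancel₀ _ hw'.ne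
      have e2 : α y / β y * β y = α y := div_mul_cancel₀ _ hβ.ne
      have h1 : α w / β w + t ≤ 0 := by
        by_contra! hc
        nlinarith
      nlinarith
    · obtain ⟨w, hw, hle⟩ := m₃ y (by simp [hy, hβ])
      have hw' : β w = 0 := (Finset.mem_filter.1 (h₃ hw)).2
      have h0 := h w (by simp [hw])
      rw [hw'] at h0
      rw [hβ]
      linarith
    · obtain ⟨w, hw, hle⟩ := m₁ y (by simp [hy, hβ])
      have hw' : 0 < β w := (Finset.mem_filter.1 (h₁ hw)).2
      have h0 := h w (by simp [hw])
      have e1 : α w / β w * β w = α w := div_mul_cancel₀ _ hw'.ne'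
      have e2 : α y / β y * β y = α y := div_mul_cancel₀ _ hβ.ne'
      have h1 : 0 ≤ α w / β w + t := by
        by_contra! hc
        nlinarith
      nlinarith

variable (X) in
/-- Every set of segments has a subset of at most `K` segments such that all segments that cross
those of the subset cross those of the whole set. -/
def HasRepresentatives (n K : ℕ) : Prop :=
  ∀ Y : Finset ℕ, (∀ y ∈ Y, y < n) → ∃ W ⊆ Y, W.card ≤ K ∧
    ∀ z < n, (∀ w ∈ W, Cross X w z) → ∀ y ∈ Y, Cross X y z

/-- Each line contributes two members of `Y` with extreme free endpoints on it (`P`) and three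
members whose supporting lines cut out the tightest half-lines on it (`H`). The two halves of
`Cross` are then settled separately: the first on the line that carries the free endpoint of `y`,
the second on the line that carries that of `z`. The order of `y` and `z` plays no role. -/
theorem hasRepresentatives {n k : ℕ} {g : ℝ} (hg : ∀ i < n, X 1 i = g)
    {qx qy vx vy : Fin k → ℝ}
    (hline : ∀ i < n, ∃ (w : Fin k) (t : ℝ), X 2 i = qx w + vx w * t ∧ X 3 i = qy w + vy w * t) :
    HasRepresentatives X n (5 * k) := by
  intro Y hY
  choose l t hx hy_eq using hline
  choose P hPY hPc hP using fun w : Fin k =>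
    exists_extreme_points (Y.filter fun y => ∃ h : y < n, l y h = w)
      (fun y => if h : y < n then t y h else 0)
  choose H hHY hHc hH using fun w : Fin k =>
    exists_extreme_halflines Y (fun y => X 0 y + tilt X y * (qy w - g) - qx w)
      (fun y => tilt X y * vy w - vx w)
  refine ⟨Finset.univ.biUnion fun w => P w ∪ H w, ?_, ?_, ?_⟩
  · intro y hy
    obtain ⟨w, -, h⟩ := Finset.mem_biUnion.1 hy
    rcases Finset.mem_union.1 h with h | h
    · exact (Finset.mem_filter.1 (hPY w h)).1
    · exact hHY w h
  · calc _ ≤ ∑ w : Fin k, (P w ∪ H w).card := Finset.card_biUnion_le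
      _ ≤ ∑ _w : Fin k, 5 := Finset.sum_le_sum fun w _ =>
          (Finset.card_union_le _ _).trans (add_le_add (hPc w) (hHc w))
      _ = 5 * k := by simp [mul_comm]
  · intro z hz hW y hy
    have hyn := hY y hy
    constructor
    · have := hP (l y hyn) (qx (l y hyn) - X 0 z - tilt X z * (qy (l y hyn) - g))
        (vx (l y hyn) - tilt X z * vy (l y hyn)) ?_ y (by simp [hy, hyn])
      · rw [hx y hyn, hy_eq y hyn, hg y hyn]
        simp only [hyn, dif_pos] at this
        linarith
      · intro w hw
        obtain ⟨hwY, hwn, hl⟩ := Finset.mem_filter.1 (hPY _ hw)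
        have h1 := (hW w (Finset.mem_biUnion.2 ⟨l y hyn, Finset.mem_univ _,
          Finset.mem_union_left _ hw⟩)).1
        rw [hx w hwn, hy_eq w hwn, hg w hwn, hl] at h1
        simp only [hwn, dif_pos]
        linarith
    · have := hH (l z hz) (t z hz) ?_ y hy
      · rw [hx z hz, hy_eq z hz, hg z hz]
        linarith
      · intro w hw
        have h1 := (hW w (Finset.mem_biUnion.2 ⟨l z hz, Finset.mem_univ _,
          Finset.mem_union_right _ hw⟩)).2
        rw [hx z hz, hy_eq z hz, hg z hz] at h1
        linarith

/-! ### Paths of tuples -/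

variable (X) in
/-- The tuple `c'` may follow the tuple `c`: its first entry is a later segment that crosses those
of `c`, and all segments that cross those of `c'` cross those of `c`. -/
def Step (n K c c' : ℕ) : Prop :=
  (key X (entry n 0 c) < key X (entry n 0 c') ∧
    ∀ j < K, Cross X (entry n j c) (entry n 0 c')) ∧
  ∀ z < n, (∀ j < K, Cross X (entry n j c') z) → ∀ j < K, Cross X (entry n j c) z

variable (X) in
/-- There is a path of `m` steps that ends in the tuple `c`. -/
inductive IsPathEnd (n K : ℕ) : ℕ → ℕ → Prop
  | start {c : ℕ} (hc : c < n ^ K) : IsPathEnd n K 0 c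
  | step {m c c' : ℕ} (h : IsPathEnd n K m c) (hs : Step X n K c c') (hc' : c' < n ^ K) :
      IsPathEnd n K (m + 1) c'

theorem IsPathEnd.lt {n K m c : ℕ} (h : IsPathEnd X n K m c) : c < n ^ K := by
  cases h <;> assumption

/-- Induction that removes the last segment `a` in the order of `key`. The new tuple consists of `a`
and representatives of the whole enlarged clique, so it controls in particular the old tuple, whose
entries lie in the smaller clique. That all entries lie in `C` and represent it is carried along for
the induction. -/
theorem exists_isPathEnd {n K : ℕ} (hrep : HasRepresentatives X n K) (C : Finset ℕ)
    (hCn : ∀ i ∈ C, i < n) (hC : ∀ i ∈ C, ∀ j ∈ C, key X i < key X j → Cross X i j)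
    (hne : C.Nonempty) :
    ∃ c m, IsPathEnd X n (K + 1) m c ∧ C.card = m + 1 ∧ (∀ j < K + 1, entry n j c ∈ C) ∧
      ∀ z < n, (∀ j < K + 1, Cross X (entry n j c) z) → ∀ y ∈ C, Cross X y z := by
  induction C using Finset.induction_on_max_value (key X) with
  | empty => simp at hne
  | insert a C ha hmax ih =>
    have han : a < n := hCn a (by simp)
    obtain ⟨W, hWC, hWc, hW⟩ := hrep (insert a C) hCn
    obtain ⟨c', hc', h0, hmem, hex⟩ := exists_tuple han (fun w hw => hCn w (hWC hw)) hWc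
    have hmem' : ∀ j < K + 1, entry n j c' ∈ insert a C := fun j hj =>
      (Finset.insert_subset (Finset.mem_insert_self a C) hWC) (hmem j hj)
    have hrepr : ∀ z < n, (∀ j < K + 1, Cross X (entry n j c') z) →
        ∀ y ∈ insert a C, Cross X y z := by
      intro z hz h
      refine hW z hz fun w hw => ?_
      obtain ⟨j, hj, rfl⟩ := hex w hw
      exact h j hj
    rcases C.eq_empty_or_nonempty with rfl | hCne
    · exact ⟨c', 0, .start hc', by simp, hmem', hrepr⟩
    · obtain ⟨c, m, hp, hcard, hcC, hcr⟩ := ih (fun i hi => hCn i (by simp [hi]))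
        (fun i hi j hj => hC i (by simp [hi]) j (by simp [hj])) hCne
      have hlt : ∀ y ∈ C, key X y < key X a := fun y hy =>
        lt_of_le_of_ne (hmax y hy) fun e => ha (key_injective e ▸ hy)
      refine ⟨c', m + 1, .step hp ⟨⟨?_, fun j hj => ?_⟩, fun z hz h j hj => ?_⟩ hc',
        by rw [Finset.card_insert_of_notMem ha, hcard], hmem', hrepr⟩
      · rw [h0]
        exact hlt _ (hcC 0 (by omega))
      · rw [h0]
        exact hC _ (Finset.mem_insert_of_mem (hcC j hj)) _ (by simp) (hlt _ (hcC j hj))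
      · exact hrepr z hz h _ (Finset.mem_insert_of_mem (hcC j hj))

/-! ### Segments as sets of points -/

/-- A segment that is not horizontal is parametrized by height. -/
theorem mem_points_iff {s : Seg} (h : s.grounded.2 < s.free.2) {p : ℝ × ℝ} :
    p ∈ s.points ↔ s.grounded.2 ≤ p.2 ∧ p.2 ≤ s.free.2 ∧ p.1 = s.grounded.1 +
      (s.free.1 - s.grounded.1) / (s.free.2 - s.grounded.2) * (p.2 - s.grounded.2) := by
  have hpos : 0 < s.free.2 - s.grounded.2 := by linarith
  rw [Seg.points, segment_eq_image']
  constructor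
  · rintro ⟨θ, ⟨h0, h1⟩, rfl⟩
    simp only [Prod.fst_add, Prod.snd_add, Prod.smul_fst, Prod.smul_snd, Prod.fst_sub, Prod.snd_sub,
      smul_eq_mul]
    refine ⟨by nlinarith, by nlinarith, ?_⟩
    field_simp
    ring
  · rintro ⟨h0, h1, h2⟩
    refine ⟨(p.2 - s.grounded.2) / (s.free.2 - s.grounded.2),
      ⟨div_nonneg (by linarith) hpos.le, (div_le_one hpos).2 (by linarith)⟩, ?_⟩
    apply Prod.ext
    · simp only [Prod.fst_add, Prod.smul_fst, Prod.fst_sub, smul_eq_mul]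
      rw [h2]
      field_simp
    · simp only [Prod.snd_add, Prod.smul_snd, Prod.snd_sub, smul_eq_mul]
      field_simp
      ring

/-- Of two segments grounded at height `g`, the first one to the left of the second one, each
reaches beyond the line through the other if and only if they intersect. -/
theorem points_inter_nonempty_iff {s s' : Seg} {g c c' : ℝ} (hs : s.grounded.2 = g)
    (hs' : s'.grounded.2 = g) (hf : g < s.free.2) (hf' : g < s'.free.2)
    (hc : c = (s.free.1 - s.grounded.1) / (s.free.2 - s.grounded.2))
    (hc' : c' = (s'.free.1 - s'.grounded.1) / (s'.free.2 - s'.grounded.2))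
    (hle : s.grounded.1 < s'.grounded.1 ∨ s.grounded.1 = s'.grounded.1 ∧ c' ≤ c) :
    (s.points ∩ s'.points).Nonempty ↔
      s'.grounded.1 + c' * (s.free.2 - s.grounded.2) ≤ s.free.1 ∧
      s'.free.1 ≤ s.grounded.1 + c * (s'.free.2 - s'.grounded.2) := by
  have e : c * (s.free.2 - g) = s.free.1 - s.grounded.1 := by
    rw [hc, hs]; exact div_mul_cancel₀ _ (by linarith)
  have e' : c' * (s'.free.2 - g) = s'.free.1 - s'.grounded.1 := by
    rw [hc', hs']; exact div_mul_cancel₀ _ (by linarith)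
  rw [hs, hs']
  constructor
  · rintro ⟨p, hp, hp'⟩
    rw [mem_points_iff (by linarith), ← hc, hs] at hp
    rw [mem_points_iff (by linarith), ← hc', hs'] at hp'
    obtain ⟨h1, h2, h3⟩ := hp
    obtain ⟨-, h5, h6⟩ := hp'
    -- If the left segment leaned less to the right than the other one, they would diverge above the
    -- ground and could not share `p`.
    have hcc : c' ≤ c := by
      rcases hle with h | h
      · by_contra! hlt
        nlinarith
      · exact h.2
    have hcc' : 0 ≤ c - c' := by linarith
    constructor <;> nlinarith
  · rintro ⟨h1, h2⟩
    have hcc : c' ≤ c := by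
      rcases hle with h | h
      · by_contra! hlt
        nlinarith
      · exact h.2
    have hpt : ∃ u, 0 ≤ u ∧ u ≤ s.free.2 - g ∧ u ≤ s'.free.2 - g ∧
        s.grounded.1 + c * u = s'.grounded.1 + c' * u := by
      rcases hle with h | h
      -- Parallel lines with different grounded endpoints would violate `h1`; so the supporting
      -- lines meet, and `u` is the height of their meeting point above the ground.
      · have hlt : 0 < c - c' := by
          rcases hcc.lt_or_eq with h' | h'
          · linarith
          · subst h'; nlinarith
        refine ⟨(s'.grounded.1 - s.grounded.1) / (c - c'), div_nonneg (by linarith) hlt.le, ?_, ?_,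
          ?_⟩
        · rw [div_le_iff₀ hlt]; nlinarith
        · rw [div_le_iff₀ hlt]; nlinarith
        · field_simp
          ring
      · exact ⟨0, le_rfl, by linarith, by linarith, by rw [h.1]; ring⟩
    obtain ⟨u, h3, h4, h5, h6⟩ := hpt
    refine ⟨(s.grounded.1 + c * u, g + u), ?_, ?_⟩
    · rw [mem_points_iff (by linarith), ← hc, hs]
      exact ⟨by simpa using h3, by simp only; linarith, by simp⟩
    · rw [mem_points_iff (by linarith), ← hc', hs']
      exact ⟨by simpa using h3, by simp only; linarith, by simp [h6]⟩

end GroundedSegments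

/-! ### The program

The arrays of natural numbers are used as follows.  Input and output: `0` and `1`.  Number of
tuples: `2`, computed with the help of `3` and `4`.  Quotients and remainders of the numbers of
tuples modulo the number of segments: `6` and `7`, computed with the loop variable `5`.  Lengths of
the longest known paths and predecessors, shifted by one, on such paths: `13` and `14`, computed
with the loop variables `8`, `9` (end of a step), `10` (start of a step) and `11` and with the flag
`12`.  End of a longest path: `15`, computed with the loop variable `16`.  Current tuple of the
path, shifted by one: `17`, with the loop variable `18`. -/

namespace GroundedSegments

open RealRAM

/-- The `K`-th power of the number of segments. -/
def sizeProg : ℕ → Prog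
  | 0 => .assign 2 (.const 1)
  | K + 1 => .seq (sizeProg K) (.seq (.assign 3 (.const 0))
      (.seq (.forLoop 4 (.var 0) (.assign 3 (.add (.var 3) (.var 2)))) (.assign 2 (.var 3))))

/-- There is no multiplication of natural numbers, so each power is the sum of `n` copies of the
preceding one, accumulated in `3` while `2` stays intact. -/
theorem reaches_sizeProg {m n : ℕ} (hn : n ≤ m) (K : ℕ) (s : State) (hs : s.nat 0 0 = n) :
    Reaches m (sizeProg K) s fun s' => SameExcept {2, 3, 4} s s' ∧ s'.nat 2 0 = n ^ K := by
  induction K with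
  | zero =>
    refine reaches_natSet ⟨(SameExcept.refl _ _).setNat (by simp) _ _, ?_⟩
    simp [NExp.eval]
  | succ K ih =>
    refine reaches_seq (ih.mono ?_)
    rintro s₁ ⟨h₁, h₂⟩
    refine reaches_seq (reaches_natSet (reaches_seq (reaches_forLoop
      (fun i s' => SameExcept {2, 3, 4} s s' ∧ s'.nat 2 0 = n ^ K ∧ s'.nat 3 0 = i * n ^ K)
      hn ?_ ?_ ?_ ?_ ?_)))
    · rintro i s' x ⟨h, h', h''⟩
      exact ⟨h.setNat (by simp) _ _, by simpa using h', by simpa using h''⟩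
    · rintro i s' ⟨h, -⟩
      simp [NExp.eval, h.2 0 (by simp), hs]
    · exact ⟨h₁.setNat (by simp) _ _, by simpa [NExp.eval] using h₂, by simp [NExp.eval]⟩
    · rintro i s' hi hv ⟨h, h', h''⟩
      refine reaches_natSet ⟨by simpa [NExp.eval] using hv, h.setNat (by simp) _ _, ?_, ?_⟩
      · simpa [NExp.eval] using h'
      · simp [NExp.eval, h', h'']
        ring
    · rintro s' ⟨h, h', h''⟩
      refine reaches_natSet ⟨h.setNat (by simp) _ _, ?_⟩
      simp [NExp.eval, h'', pow_succ, mul_comm]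

/-- Quotients and remainders modulo the number of segments. -/
def divModProg : Prog :=
  .forLoop 5 (.var 2) (.ite (.natLt (.add (.get 7 (.var 5)) (.const 1)) (.var 0))
    (.seq (.natSet 7 (.add (.var 5) (.const 1)) (.add (.get 7 (.var 5)) (.const 1)))
      (.natSet 6 (.add (.var 5) (.const 1)) (.get 6 (.var 5))))
    (.seq (.natSet 7 (.add (.var 5) (.const 1)) (.const 0))
      (.natSet 6 (.add (.var 5) (.const 1)) (.add (.get 6 (.var 5)) (.const 1)))))

theorem reaches_divModProg {m n N : ℕ} (hn : 0 < n) (hN : N ≤ m) (s : State)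
    (hs : s.nat 0 0 = n) (hsN : s.nat 2 0 = N) (h6 : s.nat 6 0 = 0) (h7 : s.nat 7 0 = 0) :
    Reaches m divModProg s fun s' => SameExcept {5, 6, 7} s s' ∧
      ∀ c < N, s'.nat 6 c = c / n ∧ s'.nat 7 c = c % n := by
  refine reaches_forLoop (fun i s' => SameExcept {5, 6, 7} s s' ∧
    ∀ c ≤ i, s'.nat 6 c = c / n ∧ s'.nat 7 c = c % n) hN ?_ ?_ ?_ ?_ ?_
  · rintro i s' x ⟨h, h'⟩
    exact ⟨h.setNat (by simp) _ _, by simpa using h'⟩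
  · rintro i s' ⟨h, -⟩
    simp [NExp.eval, h.2 2 (by simp), hsN]
  · refine ⟨SameExcept.refl _ _, fun c hc => ?_⟩
    obtain rfl : c = 0 := by omega
    simp [h6, h7]
  · rintro i s' hi hv ⟨h, h'⟩
    have hn' : s'.nat 0 0 = n := by rw [h.2 0 (by simp), hs]
    obtain ⟨hq, hr⟩ := h' i le_rfl
    have hdm := Nat.div_add_mod i n
    refine reaches_ite (fun hb => ?_) (fun hb => ?_) <;>
      simp only [Test.Holds, NExp.eval, hn', hv, hr] at hb <;>
      refine reaches_seq (reaches_natSet (reaches_natSet ⟨by simpa [NExp.eval] using hv,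
        (h.setNat (by simp) _ _).setNat (by simp) _ _, fun c hc => ?_⟩)) <;>
      simp only [State.setNat_nat, NExp.eval, hv, hr] <;>
      rcases hc.lt_or_eq with hc | rfl
    · have := h' c (by omega)
      have hne : c ≠ i + 1 := by omega
      simp [this, hne]
    · have := (Nat.div_mod_unique (a := i + 1) (b := n) (c := i % n + 1) (d := i / n) hn).2
        ⟨by omega, hb⟩
      simp [this.1, this.2, hq]
    · have := h' c (by omega)
      have hne : c ≠ i + 1 := by omega
      simp [this, hne]
    · have hlt := Nat.mod_lt i hn
      have := (Nat.div_mod_unique (a := i + 1) (b := n) (c := 0) (d := i / n + 1) hn).2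
        ⟨by rw [Nat.mul_add]; omega, hn⟩
      simp [this.1, this.2, hq]
  · rintro s' ⟨h, h'⟩
    exact ⟨h, fun c hc => h' c hc.le⟩

/-- The memory presents the segments, and the tables of quotients and remainders of the numbers
below `N` are complete. -/
def Ready (X : ℕ → ℕ → ℝ) (n N : ℕ) (s : State) : Prop :=
  s.real = X ∧ s.nat 0 0 = n ∧ s.nat 2 0 = N ∧ ∀ c < N, s.nat 6 c = c / n ∧ s.nat 7 c = c % n

variable {X : ℕ → ℕ → ℝ} {n N : ℕ} {s : State}

theorem Ready.sameExcept {A : Set ℕ} {s' : State} (h : Ready X n N s) (hs : SameExcept A s s')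
    (h0 : 0 ∉ A) (h2 : 2 ∉ A) (h6 : 6 ∉ A) (h7 : 7 ∉ A) : Ready X n N s' := by
  rw [Ready, hs.1, hs.2 0 h0, hs.2 2 h2, hs.2 6 h6, hs.2 7 h7]
  exact h

theorem Ready.setNat (h : Ready X n N s) {a : ℕ} (ha : a ∉ ({0, 2, 6, 7} : Set ℕ)) (i v : ℕ) :
    Ready X n N (s.setNat a i v) := by
  simp only [Set.mem_insert_iff, Set.mem_singleton_iff, not_or] at ha
  refine h.sameExcept ((SameExcept.refl {a} s).setNat rfl i v) ?_ ?_ ?_ ?_ <;>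
    simp only [Set.mem_singleton_iff] <;> omega

/-- An expression for `entry n j c`, where `c` is the value of `e`. -/
def entryExp : ℕ → NExp → NExp
  | 0, e => .get 7 e
  | j + 1, e => entryExp j (.get 6 e)

/-- Looking up quotients `j` times divides by `n ^ j`. A quotient never exceeds the dividend, so the
lookups stay within the completed part of the tables. -/
theorem Ready.eval_entryExp (h : Ready X n N s) (j : ℕ) (e : NExp) (he : e.eval s < N) :
    (entryExp j e).eval s = entry n j (e.eval s) := by
  induction j generalizing e with
  | zero => simp [entryExp, NExp.eval, entry, (h.2.2.2 _ he).2]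
  | succ j ih =>
    have h6 : (NExp.get 6 e).eval s = e.eval s / n := (h.2.2.2 _ he).1
    have hlt : (NExp.get 6 e).eval s < N := by
      rw [h6]
      exact (Nat.div_le_self _ _).trans_lt he
    rw [entryExp, ih _ hlt, h6, entry, entry, Nat.div_div_eq_div_mul, pow_succ']

/-- An expression for `tilt`. -/
def tiltExp (e : NExp) : RExp := .div (.sub (.get 2 e) (.get 0 e)) (.sub (.get 3 e) (.get 1 e))

/-- A test for `Cross`. -/
def crossTest (e f : NExp) : Test :=
  .and (.not (.realLt (.get 2 e) (.add (.get 0 f) (.mul (tiltExp f) (.sub (.get 3 e) (.get 1 e))))))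
    (.not (.realLt (.add (.get 0 e) (.mul (tiltExp e) (.sub (.get 3 f) (.get 1 f)))) (.get 2 f)))

theorem holds_crossTest {e f : NExp} :
    (crossTest e f).Holds s ↔ Cross s.real (e.eval s) (f.eval s) := by
  simp [crossTest, Test.Holds, Cross, tiltExp, RExp.eval, tilt]

/-- A test for the order of the segments. -/
def keyTest (e f : NExp) : Test :=
  .or (.realLt (.get 0 e) (.get 0 f)) (.and (.not (.realLt (.get 0 f) (.get 0 e)))
    (.or (.realLt (tiltExp f) (tiltExp e))
      (.and (.not (.realLt (tiltExp e) (tiltExp f))) (.natLt e f))))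

theorem holds_keyTest {e f : NExp} :
    (keyTest e f).Holds s ↔ key s.real (e.eval s) < key s.real (f.eval s) := by
  simp only [keyTest, Test.holds_or, Test.Holds, key_lt_key, tiltExp, RExp.eval, not_lt]
  change _ ∨ _ ∧ (tilt _ _ < tilt _ _ ∨ tilt _ _ ≤ tilt _ _ ∧ _) ↔ _
  simp only [le_iff_lt_or_eq]
  tauto

/-- Puts into the flag whether there is a step from the tuple in the variable `10` to the tuple in
the variable `9`. -/
def stepProg (K : ℕ) : Prog :=
  .seq (.ite (.and (keyTest (entryExp 0 (.var 10)) (entryExp 0 (.var 9)))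
      (.all (fun j => crossTest (entryExp j (.var 10)) (entryExp 0 (.var 9))) K))
    (.assign 12 (.const 1)) (.assign 12 (.const 0)))
  (.forLoop 11 (.var 0) (.ite
    (.and (.all (fun j => crossTest (entryExp j (.var 9)) (.var 11)) K)
      (.not (.all (fun j => crossTest (entryExp j (.var 10)) (.var 11)) K)))
    (.assign 12 (.const 0)) .skip))

theorem reaches_stepProg {m K c c' : ℕ} (hm : n ≤ m) (hs : Ready X n N s) (hc : c < N)
    (hc' : c' < N) (h10 : s.nat 10 0 = c) (h9 : s.nat 9 0 = c') :
    Reaches m (stepProg K) s fun s' => SameExcept {11, 12} s s' ∧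
      (0 < s'.nat 12 0 ↔ Step X n K c c') := by
  have ready : ∀ {s'}, SameExcept {11, 12} s s' → Ready X n N s' := fun h =>
    hs.sameExcept h (by simp) (by simp) (by simp) (by simp)
  have entry10 : ∀ {s'}, SameExcept {11, 12} s s' → ∀ j,
      (entryExp j (.var 10)).eval s' = entry n j c := fun {s'} h j => by
    have e : (NExp.var 10).eval s' = c := by simp [NExp.eval, h.2 10 (by simp), h10]
    rw [(ready h).eval_entryExp _ _ (by rw [e]; exact hc), e]
  have entry9 : ∀ {s'}, SameExcept {11, 12} s s' → ∀ j,
      (entryExp j (.var 9)).eval s' = entry n j c' := fun {s'} h j => by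
    have e : (NExp.var 9).eval s' = c' := by simp [NExp.eval, h.2 9 (by simp), h9]
    rw [(ready h).eval_entryExp _ _ (by rw [e]; exact hc'), e]
  have first : Reaches m (.ite (.and (keyTest (entryExp 0 (.var 10)) (entryExp 0 (.var 9)))
      (.all (fun j => crossTest (entryExp j (.var 10)) (entryExp 0 (.var 9))) K))
      (.assign 12 (.const 1)) (.assign 12 (.const 0))) s fun s' => SameExcept {11, 12} s s' ∧
        (0 < s'.nat 12 0 ↔ key X (entry n 0 c) < key X (entry n 0 c') ∧
          ∀ j < K, Cross X (entry n j c) (entry n 0 c')) := by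
    have hrefl := SameExcept.refl {11, 12} s
    refine reaches_ite (fun hb => ?_) (fun hb => ?_) <;>
      simp only [Test.Holds, holds_keyTest, Test.holds_all, holds_crossTest, entry10 hrefl,
        entry9 hrefl, hs.1] at hb <;>
      refine reaches_natSet ⟨hrefl.setNat (by simp) _ _, ?_⟩
    · simpa [NExp.eval] using hb
    · simpa [NExp.eval] using hb
  refine reaches_seq (first.mono ?_)
  rintro s₁ ⟨h₁, hflag⟩
  refine reaches_forLoop (fun i s' => SameExcept {11, 12} s s' ∧ (0 < s'.nat 12 0 ↔
    (key X (entry n 0 c) < key X (entry n 0 c') ∧ ∀ j < K, Cross X (entry n j c) (entry n 0 c')) ∧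
    ∀ z < i, (∀ j < K, Cross X (entry n j c') z) → ∀ j < K, Cross X (entry n j c) z))
    hm ?_ ?_ ?_ ?_ ?_
  · rintro i s' x ⟨h, h'⟩
    exact ⟨h.setNat (by simp) _ _, by simpa using h'⟩
  · rintro i s' ⟨h, -⟩
    simp [NExp.eval, (ready h).2.1]
  · exact ⟨h₁, by simpa using hflag⟩
  · rintro i s' hi hv ⟨h, h'⟩
    refine reaches_ite (fun hb => ?_) (fun hb => ?_) <;>
      simp only [Test.Holds, Test.holds_all, holds_crossTest, entry10 h, entry9 h, (ready h).1] at hb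
    · refine reaches_natSet ⟨by simpa [NExp.eval] using hv, h.setNat (by simp) _ _, ?_⟩
      have hv' : (NExp.var 11).eval s' = i := hv
      rw [hv'] at hb
      simp only [State.setNat_nat, NExp.eval, and_self, if_true, lt_irrefl, false_iff]
      exact fun hst => hb.2 (hst.2 i (by omega) hb.1)
    · refine reaches_skip ⟨hv, h, h'.trans ?_⟩
      have hv' : (NExp.var 11).eval s' = i := hv
      rw [hv', not_and, not_not] at hb
      refine and_congr_right fun _ => ⟨fun hz z hzi => ?_, fun hz z hzi => hz z (by omega)⟩
      rcases Nat.lt_succ_iff_lt_or_eq.1 hzi with hlt | rfl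
      · exact hz z hlt
      · exact hb
  · exact fun s' h => h

variable (X) in
/-- The lengths are those of paths along the predecessors. -/
def PathTable (n K N : ℕ) (s : State) : Prop :=
  ∀ c < N, s.nat 14 c = 0 ∧ s.nat 13 c = 0 ∨
    ∃ b < N, s.nat 14 c = b + 1 ∧ Step X n K b c ∧ s.nat 13 c ≤ s.nat 13 b + 1

/-- The lengths of the longest paths to all tuples, in `n` rounds. -/
def pathProg (K : ℕ) : Prog :=
  .forLoop 8 (.var 0) (.forLoop 9 (.var 2) (.forLoop 10 (.var 2) (.seq (stepProg K)
    (.ite (.and (.natLt (.const 0) (.var 12))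
        (.natLt (.get 13 (.var 9)) (.add (.get 13 (.var 10)) (.const 1))))
      (.seq (.natSet 13 (.var 9) (.add (.get 13 (.var 10)) (.const 1)))
        (.natSet 14 (.var 9) (.add (.var 10) (.const 1))))
      .skip))))

/-- Relaxation of all pairs as in the Bellman–Ford algorithm: after `i` rounds the lengths dominate
those of all paths of at most `i` steps, while `PathTable` bounds them from above along the
predecessors. -/
theorem reaches_pathProg {m K : ℕ} (hm : n ≤ m) (hN : N ≤ m) (hNn : N = n ^ K)
    (hs : Ready X n N s) (hP : PathTable X n K N s) :
    Reaches m (pathProg K) s fun s' => SameExcept {8, 9, 10, 11, 12, 13, 14} s s' ∧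
      PathTable X n K N s' ∧
      ∀ r < n, ∀ c, IsPathEnd X n K r c → r ≤ s'.nat 13 c := by
  let Inv : ℕ → State → Prop := fun i s' =>
    SameExcept {8, 9, 10, 11, 12, 13, 14} s s' ∧ PathTable X n K N s' ∧
      ∀ r ≤ i, ∀ c, IsPathEnd X n K r c → r ≤ s'.nat 13 c
  -- `D c' c` says that the pair has already been relaxed in the current round.
  let Inv' : ℕ → (ℕ → ℕ → Prop) → State → Prop := fun i D s' =>
    Inv i s' ∧ ∀ c' c, D c' c → Step X n K c c' →
      ∀ r ≤ i, IsPathEnd X n K r c → r + 1 ≤ s'.nat 13 c'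
  have stable : ∀ i s' v x, v ∈ ({8, 9, 10} : Set ℕ) → Inv i s' → Inv i (s'.setNat v 0 x) := by
    rintro i s' v x hv ⟨h1, h2, h3⟩
    simp only [Set.mem_insert_iff, Set.mem_singleton_iff] at hv
    have h13 : v ≠ 13 := by omega
    have h14 : v ≠ 14 := by omega
    refine ⟨h1.setNat ?_ _ _, ?_, ?_⟩
    · simp only [Set.mem_insert_iff, Set.mem_singleton_iff]
      omega
    · simpa [PathTable, h13.symm, h14.symm] using h2
    · simpa [h13.symm] using h3
  have stable' : ∀ i D s' v x, v ∈ ({8, 9, 10} : Set ℕ) → Inv' i D s' →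
      Inv' i D (s'.setNat v 0 x) := by
    rintro i D s' v x hv ⟨h1, h2⟩
    refine ⟨stable i s' v x hv h1, ?_⟩
    simp only [Set.mem_insert_iff, Set.mem_singleton_iff] at hv
    have h13 : v ≠ 13 := by omega
    simpa [h13.symm] using h2
  have ready : ∀ {i s'}, Inv i s' → Ready X n N s' := fun h =>
    hs.sameExcept h.1 (by simp) (by simp) (by simp) (by simp)
  refine reaches_forLoop Inv hm (fun i s' x => stable i s' 8 x (by simp)) (fun i s' h => (ready h).2.1)
    ⟨SameExcept.refl _ _, hP, fun r hr _ _ => by omega⟩ ?_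
    fun s' h => ⟨h.1, h.2.1, fun r hr => h.2.2 r hr.le⟩
  intro i s₁ hi h8 hI
  refine reaches_forLoop (fun t s' => s'.nat 8 0 = i ∧ Inv' i (fun c' _ => c' < t) s') hN
    (fun t s' x h => ⟨by simpa using h.1, stable' i _ s' 9 x (by simp) h.2⟩)
    (fun t s' h => (ready h.2.1).2.2.1) ⟨h8, hI, fun _ _ h => by omega⟩ ?_ ?_
  swap
  · rintro s' ⟨h8', h, h'⟩
    refine ⟨h8', h.1, h.2.1, fun r hr c' hpath => ?_⟩
    cases hpath with
    | start hc => exact Nat.zero_le _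
    | step hp hst hc' => exact h' _ _ (hNn ▸ hc') hst _ (by omega) hp
  intro t s₂ ht h9 hI₂
  refine reaches_forLoop (fun u s' => (s'.nat 8 0 = i ∧ s'.nat 9 0 = t) ∧
      Inv' i (fun c' c => c' < t ∨ c' = t ∧ c < u) s') hN
    (fun u s' x h => ⟨by simpa using h.1, stable' i _ s' 10 x (by simp) h.2⟩)
    (fun u s' h => (ready h.2.1).2.2.1)
    ⟨⟨hI₂.1, h9⟩, hI₂.2.1, fun c' c h => hI₂.2.2 c' c (by omega)⟩ ?_ ?_
  swap
  · rintro s' ⟨⟨h8', h9'⟩, h, h'⟩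
    refine ⟨h9', h8', h, fun c' c hc' hst r hr hp => h' c' c ?_ hst r hr hp⟩
    have := hp.lt
    omega
  rintro u s₃ hu h10 ⟨⟨h8', h9'⟩, h, h'⟩
  refine reaches_seq ((reaches_stepProg hm (ready h) hu ht h10 h9').mono ?_)
  rintro s₄ ⟨hsame, hflag⟩
  have h8₄ : s₄.nat 8 0 = i := by rw [hsame.2 8 (by simp), h8']
  have h9₄ : s₄.nat 9 0 = t := by rw [hsame.2 9 (by simp), h9']
  have h10₄ : s₄.nat 10 0 = u := by rw [hsame.2 10 (by simp), h10]
  have h13 : s₄.nat 13 = s₃.nat 13 := hsame.2 13 (by simp)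
  have h14 : s₄.nat 14 = s₃.nat 14 := hsame.2 14 (by simp)
  have hsame' : SameExcept {8, 9, 10, 11, 12, 13, 14} s s₄ := by
    refine ⟨hsame.1.trans h.1.1, fun a ha => ?_⟩
    rw [hsame.2 a (fun h => ha (by
      simp only [Set.mem_insert_iff, Set.mem_singleton_iff] at h ⊢
      omega)), h.1.2 a ha]
  refine reaches_ite (fun hb => ?_) (fun hb => ?_) <;>
    simp only [Test.Holds, NExp.eval, hflag, h9₄, h10₄, h13] at hb
  · obtain ⟨hst, hlt⟩ := hb
    -- A step strictly increases `key`, hence is no loop; so writing the length of `t` leaves that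
    -- of `u` alone.
    have hut : u ≠ t := by
      rintro rfl
      exact lt_irrefl _ hst.1.1
    have hval : ∀ c, ((s₄.setNat 13 t (s₃.nat 13 u + 1)).setNat 14 t (u + 1)).nat 13 c =
        if c = t then s₃.nat 13 u + 1 else s₃.nat 13 c := by
      intro c
      simp [h13]
    have hval' : ∀ c, ((s₄.setNat 13 t (s₃.nat 13 u + 1)).setNat 14 t (u + 1)).nat 14 c =
        if c = t then u + 1 else s₃.nat 14 c := by
      intro c
      simp [h14]
    have hmono : ∀ c, s₃.nat 13 c ≤
        ((s₄.setNat 13 t (s₃.nat 13 u + 1)).setNat 14 t (u + 1)).nat 13 c := by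
      intro c
      rw [hval]
      split_ifs with hc
      · subst hc; omega
      · exact le_rfl
    refine reaches_seq (reaches_natSet (reaches_natSet ?_))
    simp only [NExp.eval, State.setNat_nat, h9₄, h10₄, h13]
    simp only [show ((9 : ℕ) = 13 ∧ 0 = t) = False by simp, if_false,
      show ((10 : ℕ) = 13 ∧ 0 = t) = False by simp]
    refine ⟨by simp, by simp [h8₄], ⟨(hsame'.setNat (by simp) _ _).setNat (by simp) _ _, ?_, ?_⟩, ?_⟩
    · intro c hc
      simp only [hval']
      by_cases hct : c = t
      · subst hct
        refine Or.inr ⟨u, hu, by simp, hst, ?_⟩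
        rw [hval, hval, if_pos rfl, if_neg hut]
      · rw [hval c, if_neg hct, if_neg hct]
        rcases h.2.1 c hc with h0 | ⟨b, hb, h1, h2, h3⟩
        · exact Or.inl h0
        -- The length of the predecessor `b` may have grown since it was recorded, which is why
        -- `PathTable` has an inequality.
        · exact Or.inr ⟨b, hb, h1, h2, h3.trans (Nat.succ_le_succ (hmono b))⟩
    · exact fun r hr c hp => (h.2.2 r hr c hp).trans (hmono c)
    · intro c' c hD hst' r hr hp
      by_cases hD' : c' < t ∨ c' = t ∧ c < u
      · exact (h' c' c hD' hst' r hr hp).trans (hmono c')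
      · obtain ⟨rfl, rfl⟩ : c' = t ∧ c = u := by omega
        rw [hval, if_pos rfl]
        exact Nat.succ_le_succ (h.2.2 r hr c hp)
  · refine reaches_skip ⟨h10₄, ⟨h8₄, h9₄⟩, ⟨hsame', ?_, ?_⟩, ?_⟩
    · simpa [PathTable, h13, h14] using h.2.1
    · simpa [h13] using h.2.2
    · intro c' c hD hst' r hr hp
      rw [h13]
      by_cases hD' : c' < t ∨ c' = t ∧ c < u
      · exact h' c' c hD' hst' r hr hp
      · obtain ⟨rfl, rfl⟩ : c' = t ∧ c = u := by omega
        rw [not_and, not_lt] at hb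
        exact (Nat.succ_le_succ (h.2.2 r hr c hp)).trans (hb hst')

/-- The end of a longest path. -/
def bestProg : Prog :=
  .forLoop 16 (.var 2)
    (.ite (.natLt (.get 13 (.var 15)) (.get 13 (.var 16))) (.assign 15 (.var 16)) .skip)

theorem reaches_bestProg {m : ℕ} (hN : N ≤ m) (hN0 : 0 < N) (hs : s.nat 2 0 = N)
    (h15 : s.nat 15 0 = 0) :
    Reaches m bestProg s fun s' => SameExcept {15, 16} s s' ∧ s'.nat 15 0 < N ∧
      ∀ c < N, s.nat 13 c ≤ s.nat 13 (s'.nat 15 0) := by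
  refine reaches_forLoop (fun i s' => SameExcept {15, 16} s s' ∧ s'.nat 15 0 < N ∧
    ∀ c < i, s.nat 13 c ≤ s.nat 13 (s'.nat 15 0)) hN ?_ ?_ ?_ ?_ ?_
  · rintro i s' x ⟨h, h'⟩
    exact ⟨h.setNat (by simp) _ _, by simpa using h'⟩
  · rintro i s' ⟨h, -⟩
    simp [NExp.eval, h.2 2 (by simp), hs]
  · exact ⟨SameExcept.refl _ _, by omega, fun c hc => by omega⟩
  · rintro i s' hi hv ⟨h, hlt, hmax⟩
    refine reaches_ite (fun hb => ?_) (fun hb => ?_) <;>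
      simp only [Test.Holds, NExp.eval, hv, h.2 13 (by simp)] at hb
    · refine reaches_natSet ⟨by simpa [NExp.eval] using hv, h.setNat (by simp) _ _, ?_, ?_⟩
      · simpa [NExp.eval, hv] using hi
      · intro c hc
        simp only [State.setNat_nat, NExp.eval, hv, and_self, if_true]
        rcases Nat.lt_succ_iff_lt_or_eq.1 hc with hc | rfl
        · exact (hmax c hc).trans hb.le
        · exact le_rfl
    · refine reaches_skip ⟨hv, h, hlt, fun c hc => ?_⟩
      rcases Nat.lt_succ_iff_lt_or_eq.1 hc with hc | rfl
      · exact hmax c hc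
      · exact not_lt.1 hb
  · exact fun s' h => h

/-- Puts out the first entries of the tuples of a longest path. -/
def outputProg : Prog :=
  .seq (.assign 17 (.add (.var 15) (.const 1))) (.forLoop 18 (.var 0)
    (.ite (.natLt (.const 0) (.var 17))
      (.seq (.natSet 1 (entryExp 0 (.sub (.var 17) (.const 1))) (.const 1))
        (.assign 17 (.get 14 (.sub (.var 17) (.const 1)))))
      .skip))

theorem reaches_outputProg {m K : ℕ} (hn : 0 < n) (hm : n ≤ m) (hs : Ready X n N s)
    (hP : PathTable X n (K + 1) N s) (h15 : s.nat 15 0 < N) (h1 : ∀ i, s.nat 1 i = 0) :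
    Reaches m outputProg s fun s' => ∃ M : Finset ℕ, (∀ i ∈ M, i < n) ∧
      (∀ i, s'.nat 1 i = if i ∈ M then 1 else 0) ∧
      (∀ i ∈ M, ∀ j ∈ M, key X i < key X j → Cross X i j) ∧
      s.nat 13 (s.nat 15 0) < M.card := by
  -- Either the path has been exhausted (`17` holds `0`), or `c` is the next tuple to be put out,
  -- every segment put out so far comes after its first entry and crosses all its entries, and the
  -- length recorded for `c` makes up for what is still missing in `M`.
  refine reaches_seq (reaches_natSet (reaches_forLoop (fun i s' => SameExcept {1, 17, 18} s s' ∧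
    ∃ M : Finset ℕ, (∀ i ∈ M, i < n) ∧ (∀ i, s'.nat 1 i = if i ∈ M then 1 else 0) ∧
      (∀ i ∈ M, ∀ j ∈ M, key X i < key X j → Cross X i j) ∧
      (s'.nat 17 0 = 0 ∧ s.nat 13 (s.nat 15 0) < M.card ∨
        ∃ c < N, s'.nat 17 0 = c + 1 ∧ M.card = i ∧ s.nat 13 (s.nat 15 0) ≤ M.card + s.nat 13 c ∧
          ∀ i ∈ M, key X (entry n 0 c) < key X i ∧ ∀ j < K + 1, Cross X (entry n j c) i))
    hm ?_ ?_ ?_ ?_ ?_))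
  · rintro i s' x ⟨h, h'⟩
    exact ⟨h.setNat (by simp) _ _, by simpa using h'⟩
  · rintro i s' ⟨h, -⟩
    simp [NExp.eval, h.2 0 (by simp), hs.2.1]
  · refine ⟨(SameExcept.refl _ _).setNat (by simp) _ _, ∅, by simp, by simp [h1], by simp,
      Or.inr ⟨s.nat 15 0, h15, ?_⟩⟩
    simp [NExp.eval]
  · rintro i s' hi hv ⟨h, M, hMn, hout, hM, hcur⟩
    have hready : Ready X n N s' := hs.sameExcept h (by simp) (by simp) (by simp) (by simp)
    refine reaches_ite (fun hb => ?_) (fun hb => ?_) <;>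
      simp only [Test.Holds, NExp.eval] at hb
    · rcases hcur with h0 | ⟨c, hc, h17, hcard, hlen, hbelow⟩
      · omega
      have he : (NExp.sub (.var 17) (.const 1)).eval s' = c := by simp [NExp.eval, h17]
      have hentry := hready.eval_entryExp 0 (.sub (.var 17) (.const 1)) (by rw [he]; exact hc)
      rw [he] at hentry
      have hnew : entry n 0 c ∉ M := fun hmem => lt_irrefl _ (hbelow _ hmem).1
      refine reaches_seq (reaches_natSet (reaches_natSet ⟨by simpa [NExp.eval] using hv,
        (h.setNat (by simp) _ _).setNat (by simp) _ _, insert (entry n 0 c) M, ?_, ?_, ?_, ?_⟩))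
      · intro i hi
        rcases Finset.mem_insert.1 hi with rfl | hi
        · exact entry_lt hn _ _
        · exact hMn i hi
      · intro i
        rw [hentry]
        simp only [State.setNat_nat, NExp.eval, Finset.mem_insert, hout]
        by_cases hi : i = entry n 0 c <;> simp [hi]
      · intro i hi j hj hij
        rcases Finset.mem_insert.1 hi with rfl | hi <;> rcases Finset.mem_insert.1 hj with rfl | hj
        · exact absurd hij (lt_irrefl _)
        · exact (hbelow j hj).2 0 (by omega)
        · exact absurd hij (hbelow i hi).1.not_gt
        · exact hM i hi j hj hij
      · rw [Finset.card_insert_of_notMem hnew]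
        simp only [NExp.eval, State.setNat_nat]
        simp only [h17, h.2 14 (by simp)]
        simp only [and_self, if_true, show ((17 : ℕ) = 1) = False by simp, false_and, if_false,
          Nat.add_sub_cancel, show ((14 : ℕ) = 1) = False by simp]
        rcases hP c hc with ⟨h14, h13⟩ | ⟨b, hb, h14, hst, h13⟩
        · exact Or.inl ⟨h14, by omega⟩
        · refine Or.inr ⟨b, hb, h14, by omega, by omega, fun i hi => ?_⟩
          rcases Finset.mem_insert.1 hi with rfl | hi
          · exact hst.1
          -- The second half of `Step` passes crossing from the tuple `c` back to its predecessor
          -- `b`.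
          · exact ⟨hst.1.1.trans (hbelow i hi).1, hst.2 i (hMn i hi) (hbelow i hi).2⟩
    · rcases hcur with h0 | ⟨c, hc, h17, -⟩
      · exact reaches_skip ⟨hv, h, M, hMn, hout, hM, Or.inl h0⟩
      · omega
  · rintro s' ⟨-, M, hMn, hout, hM, hcur⟩
    refine ⟨M, hMn, hout, hM, ?_⟩
    rcases hcur with h0 | ⟨c, hc, -, hcard, -, hbelow⟩
    · exact h0.2
    -- The path cannot outlast `n` rounds: the next first entry would be one more segment besides
    -- the `n` already in `M`.
    · have hle : (insert (entry n 0 c) M).card ≤ (Finset.range n).card := by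
        refine Finset.card_le_card fun i hi => Finset.mem_range.2 ?_
        rcases Finset.mem_insert.1 hi with rfl | hi
        · exact entry_lt hn _ _
        · exact hMn i hi
      rw [Finset.card_insert_of_notMem fun hmem => lt_irrefl _ (hbelow _ hmem).1, hcard,
        Finset.card_range] at hle
      omega

/-- The program that computes maximum cliques, using tuples of `K` segments. -/
def cliqueProg (K : ℕ) : Prog :=
  .ite (.natLt (.const 0) (.var 0))
    (.seq (sizeProg K) (.seq divModProg (.seq (pathProg K) (.seq bestProg outputProg)))) .skip

theorem reaches_cliqueProg {K : ℕ} {S : Fin n → Seg}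
    (hrep : HasRepresentatives (inputState S).real n K) :
    Reaches (n + n ^ (K + 1)) (cliqueProg (K + 1)) (inputState S) fun s' =>
      ∃ M : Finset ℕ, (∀ i ∈ M, i < n) ∧ (∀ i, s'.nat 1 i = if i ∈ M then 1 else 0) ∧
        (∀ i ∈ M, ∀ j ∈ M, key (inputState S).real i < key (inputState S).real j →
          Cross (inputState S).real i j) ∧
        ∀ C : Finset ℕ, (∀ i ∈ C, i < n) →
          (∀ i ∈ C, ∀ j ∈ C, key (inputState S).real i < key (inputState S).real j →
            Cross (inputState S).real i j) → C.card ≤ M.card := by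
  have hzero : ∀ a i, a ≠ 0 → (inputState S).nat a i = 0 := fun a i ha => by
    simp [inputState, ha]
  have hn0 : (inputState S).nat 0 0 = n := by simp [inputState]
  set s₀ := inputState S
  refine reaches_ite (fun hb => ?_) (fun hb => ?_) <;>
    simp only [Test.Holds, NExp.eval, hn0] at hb
  swap
  · refine reaches_skip ⟨∅, by simp, by simp [hzero], by simp, fun C hC _ => ?_⟩
    exact Finset.card_le_card fun i hi => absurd (hC i hi) (by omega)
  refine reaches_seq ((reaches_sizeProg (Nat.le_add_right _ _) _ _ hn0).mono ?_)
  rintro s₁ ⟨h₁, hN₁⟩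
  refine reaches_seq ((reaches_divModProg hb (Nat.le_add_left _ _) s₁ (by rw [h₁.2 0 (by simp), hn0])
    hN₁ (by rw [h₁.2 6 (by simp), hzero _ _ (by simp)])
    (by rw [h₁.2 7 (by simp), hzero _ _ (by simp)])).mono ?_)
  rintro s₂ ⟨h₂, htab⟩
  have hready : Ready s₀.real n (n ^ (K + 1)) s₂ :=
    ⟨h₂.1.trans h₁.1, by rw [h₂.2 0 (by simp), h₁.2 0 (by simp), hn0],
      by rw [h₂.2 2 (by simp), hN₁], htab⟩
  have hzero₂ : ∀ a i, 8 ≤ a ∨ a = 1 → s₂.nat a i = 0 := fun a i ha => by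
    rw [h₂.2 a (by simp only [Set.mem_insert_iff, Set.mem_singleton_iff]; omega),
      h₁.2 a (by simp only [Set.mem_insert_iff, Set.mem_singleton_iff]; omega),
      hzero _ _ (by omega)]
  refine reaches_seq ((reaches_pathProg (Nat.le_add_right _ _) (Nat.le_add_left _ _) rfl hready
    fun c _ => Or.inl ⟨hzero₂ _ _ (by simp), hzero₂ _ _ (by simp)⟩).mono ?_)
  rintro s₃ ⟨h₃, htab₃, hlen⟩
  have hready₃ := hready.sameExcept h₃ (by simp) (by simp) (by simp) (by simp)
  refine reaches_seq ((reaches_bestProg (Nat.le_add_left _ _) (Nat.pow_pos hb) hready₃.2.2.1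
    (by rw [h₃.2 15 (by simp), hzero₂ _ _ (by simp)])).mono ?_)
  rintro s₄ ⟨h₄, hlt, hbest⟩
  have hready₄ := hready₃.sameExcept h₄ (by simp) (by simp) (by simp) (by simp)
  refine (reaches_outputProg (K := K) hb (Nat.le_add_right _ _) hready₄ ?_ hlt ?_).mono ?_
  · rw [PathTable, h₄.2 13 (by simp), h₄.2 14 (by simp)]
    exact htab₃
  · intro i
    rw [h₄.2 1 (by simp), h₃.2 1 (by simp), hzero₂ _ _ (by simp)]
  · rintro s₅ ⟨M, hMn, hout, hM, hcard⟩
    refine ⟨M, hMn, hout, hM, fun C hCn hC => ?_⟩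
    rcases C.eq_empty_or_nonempty with rfl | hne
    · simp
    · obtain ⟨c, r, hp, hr, -⟩ := exists_isPathEnd hrep C hCn hC hne
      -- Since `C.card = r + 1`, this gives `r < n`, so the rounds made suffice for this path.
      have hCle : C.card ≤ n := by
        simpa using Finset.card_le_card (t := Finset.range n) fun i hi =>
          Finset.mem_range.2 (hCn i hi)
      have := hlen r (by omega) c hp
      have := hbest c hp.lt
      rw [h₄.2 13 (by simp)] at hcard
      omega

/-! ### Cliques of the intersection graph -/

theorem exists_parametrization {L : AffineSubspace ℝ (ℝ × ℝ)}
    (hL : Module.finrank ℝ L.direction = 1) :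
    ∃ q v : ℝ × ℝ, ∀ p ∈ L, ∃ t : ℝ, p = q + t • v := by
  obtain ⟨v, -, hv⟩ := finrank_eq_one_iff'.1 hL
  rcases (L : Set (ℝ × ℝ)).eq_empty_or_nonempty with hempty | ⟨q, hq⟩
  · exact ⟨0, 0, fun p hp => absurd hp (Set.eq_empty_iff_forall_notMem.1 hempty p)⟩
  · refine ⟨q, v, fun p hp => ?_⟩
    obtain ⟨t, ht⟩ := hv ⟨p -ᵥ q, L.vsub_mem_direction hp hq⟩
    refine ⟨t, ?_⟩
    have : t • (v : ℝ × ℝ) = p - q := congrArg Subtype.val ht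
    rw [this]
    abel

theorem hasRepresentatives_inputState {k : ℕ} {S : Fin n → Seg} (hS : AreGrounded S)
    (hL : FreeEndpointsOnLines k S) : HasRepresentatives (inputState S).real n (5 * k) := by
  obtain ⟨g, hg⟩ := hS
  obtain ⟨L, hrank, hmem⟩ := hL
  choose q v hqv using fun w => exists_parametrization (hrank w)
  refine hasRepresentatives (g := g) (fun i hi => by simp [inputState, hi, (hg ⟨i, hi⟩).1])
    (qx := fun w => (q w).1) (qy := fun w => (q w).2) (vx := fun w => (v w).1)
    (vy := fun w => (v w).2) fun i hi => ?_
  obtain ⟨w, hw⟩ := hmem ⟨i, hi⟩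
  obtain ⟨t, ht⟩ := hqv w _ hw
  refine ⟨w, t, ?_, ?_⟩ <;> simp [inputState, hi, ht, mul_comm]

/-- The order by `key` supplies the hypothesis of `points_inter_nonempty_iff`: the earlier segment
starts further left, or both start at the same point and the earlier one has at least the tilt of
the later. -/
theorem adj_iff_cross {S : Fin n → Seg} (hS : AreGrounded S) {i j : Fin n}
    (hij : key (inputState S).real i < key (inputState S).real j) :
    (intersectionGraph S).Adj i j ↔ Cross (inputState S).real i j := by
  obtain ⟨g, hg⟩ := hS
  have hne : i ≠ j := fun h => lt_irrefl _ (h ▸ hij)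
  have hadj : (intersectionGraph S).Adj i j ↔ ((S i).points ∩ (S j).points).Nonempty :=
    and_iff_right hne
  rw [hadj, points_inter_nonempty_iff (hg i).1 (hg j).1 (hg i).2 (hg j).2 rfl rfl]
  · simp [Cross, tilt, inputState]
  · rcases key_lt_key.1 hij with h | ⟨h, h' | ⟨h', -⟩⟩
    · exact Or.inl (by simpa [inputState] using h)
    · exact Or.inr ⟨by simpa [inputState] using h, by simpa [inputState, tilt] using h'.le⟩
    · exact Or.inr ⟨by simpa [inputState] using h, by simpa [inputState, tilt] using h'.le⟩

theorem isClique_iff {S : Fin n → Seg} (hS : AreGrounded S) (C : Finset (Fin n)) :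
    (intersectionGraph S).IsClique C ↔ ∀ i ∈ C, ∀ j ∈ C,
      key (inputState S).real i < key (inputState S).real j → Cross (inputState S).real i j := by
  constructor
  · intro h i hi j hj hij
    exact (adj_iff_cross hS hij).1 (h hi hj fun e => lt_irrefl _ (e ▸ hij))
  · intro h i hi j hj hij
    rcases lt_trichotomy (key (inputState S).real i) (key (inputState S).real j) with h' | h' | h'
    · exact (adj_iff_cross hS h').2 (h i hi j hj h')
    · exact absurd (Fin.ext (key_injective h')) hij
    · exact ((adj_iff_cross hS h').2 (h j hj i hi h')).symm

theorem findsMaximumClique_cliqueProg (k : ℕ) :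
    FindsMaximumClique (cliqueProg (5 * k + 1)) k
      fun n => (cliqueProg (5 * k + 1)).bound (n + n ^ (5 * k + 1)) := by
  intro n S hS hL
  obtain ⟨t, s, hrun, ht, M, hMn, hout, hM, hmax⟩ :=
    reaches_cliqueProg (hasRepresentatives_inputState hS hL)
  refine ⟨t, s, Finset.univ.filter fun i : Fin n => (i : ℕ) ∈ M, hrun, ht, fun i => ?_, ?_, ?_⟩
  · simp [hout]
  · rw [isClique_iff hS]
    intro i hi j hj
    exact hM i (by simpa using hi) j (by simpa using hj)
  · intro C hC
    rw [isClique_iff hS] at hC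
    have h := hmax (C.map Fin.valEmbedding) (by simp) ?_
    · have hMmap : M = (Finset.univ.filter fun i : Fin n => (i : ℕ) ∈ M).map Fin.valEmbedding := by
        ext i
        simp only [Finset.mem_map, Finset.mem_filter, Finset.mem_univ, true_and]
        exact ⟨fun hi => ⟨⟨i, hMn i hi⟩, hi, rfl⟩, by rintro ⟨j, hj, rfl⟩; exact hj⟩
      rw [hMmap] at h
      simpa only [Finset.card_map] using h
    · intro i hi j hj
      obtain ⟨i', hi', rfl⟩ := Finset.mem_map.1 hi
      obtain ⟨j', hj', rfl⟩ := Finset.mem_map.1 hj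
      exact hC i' hi' j' hj'

end GroundedSegments

/-! ### Polynomial running time -/

theorem theorem2 (k : ℕ) :
    ∃ (p : RealRAM.Prog) (T : ℕ → ℕ) (d : ℕ),
      GroundedSegments.FindsMaximumClique p k T ∧
      (fun n : ℕ => (T n : ℝ)) =O[atTop] (fun n : ℕ => (n : ℝ) ^ d) := by
  obtain ⟨C, d, h⟩ := (GroundedSegments.cliqueProg (5 * k + 1)).exists_bound_le
  refine ⟨_, _, (5 * k + 1) * d, GroundedSegments.findsMaximumClique_cliqueProg k,
    IsBigO.of_bound ((C * 3 ^ d : ℕ) : ℝ) ?_⟩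
  filter_upwards [eventually_ge_atTop 1] with n hn
  rw [Real.norm_of_nonneg (by positivity), Real.norm_of_nonneg (by positivity)]
  -- For `n ≥ 1` each of the three summands of `n + n ^ (5 * k + 1) + 1` is at most `n ^ (5 * k +
  -- 1)`; hence the constant `3 ^ d`.
  have h1 : n ≤ n ^ (5 * k + 1) := Nat.le_self_pow (by omega) n
  have h2 : n + n ^ (5 * k + 1) + 1 ≤ 3 * n ^ (5 * k + 1) := by omega
  have h3 : (GroundedSegments.cliqueProg (5 * k + 1)).bound (n + n ^ (5 * k + 1)) ≤
      C * 3 ^ d * n ^ ((5 * k + 1) * d) :=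
    calc _ ≤ C * (n + n ^ (5 * k + 1) + 1) ^ d := h _
      _ ≤ C * (3 * n ^ (5 * k + 1)) ^ d := by gcongr
      _ = _ := by rw [mul_pow, ← pow_mul, mul_assoc]
  exact_mod_cast h3
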